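/- Let $n\ge 1$ be an integer, let $\mathbb{F}_2$ be the field with two elements, and let $O_n$ and $I_n$ be the zero and identity $n\times n$ matrices over $\mathbb{F}_2$. Let $\mathcal{A}_n$, $\mathcal{B}_n$ and $\mathcal{C}_n$ be the sets of upper-triangular $n\times n$ matrices $U$ over $\mathbb{F}_2$ with, respectively, $U^2=I_n$, $U^2=O_n$, and $U^TU=O_n$ (that is, $U$ is a Cholesky root of $O_n$). Then $$|\mathcal{A}_n|=|\mathcal{B}_n|=|\mathcal{C}_n|=\sum_{j\in\mathbb{Z}}\left[\binom{n}{\lfloor n/2\rfloor-3j}-\binom{n}{\lfloor n/2\rfloor-3j-1}\right]2^{\lfloor n/2\rfloor\lceil n/2\rceil-3j^2-(\lceil n/2\rceil-\lfloor n/2\rfloor+1)j},$$ where $\binom{n}{k}=0$ for every integer $k$ with $k<0$ or $k>n$, so that only finitely many terms of the sum are nonzero. -/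

import Mathlib

/-- `U` is a Cholesky root of `M`: it is upper triangular and `Uᵀ U = M`. -/
def IsCholeskyRoot {n : ℕ} (U M : Matrix (Fin n) (Fin n) (ZMod 2)) : Prop :=
  U.IsUpperTriangular ∧ U.transpose * U = M

/-- The upper-triangular square roots of the identity matrix over the field with two elements. -/
def setA (n : ℕ) : Set (Matrix (Fin n) (Fin n) (ZMod 2)) :=
  {U | U.IsUpperTriangular ∧ U ^ 2 = 1}

/-- The upper-triangular square roots of the zero matrix over the field with two elements. -/
def setB (n : ℕ) : Set (Matrix (Fin n) (Fin n) (ZMod 2)) :=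
  {U | U.IsUpperTriangular ∧ U ^ 2 = 0}

/-- The Cholesky roots of the zero matrix over the field with two elements. -/
def setC (n : ℕ) : Set (Matrix (Fin n) (Fin n) (ZMod 2)) :=
  {U | IsCholeskyRoot U 0}

/-- The binomial coefficient `n` over `k` for a natural number `n` and an integer `k`;
it is zero when `k < 0` or `k > n`. -/
def binom (n : ℕ) (k : ℤ) : ℤ :=
  if 0 ≤ k then (n.choose k.toNat : ℤ) else 0

/-- The `j`-th term of the counting formula. The power of two is taken in the rationals, so that
it has its usual meaning also for those `j` at which the exponent is negative. -/
def countTerm (n : ℕ) (j : ℤ) : ℚ :=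
  ((binom n (⌊(n : ℚ) / 2⌋ - 3 * j) - binom n (⌊(n : ℚ) / 2⌋ - 3 * j - 1) : ℤ) : ℚ) *
    (2 : ℚ) ^ (⌊(n : ℚ) / 2⌋ * ⌈(n : ℚ) / 2⌉ - 3 * j ^ 2
      - (⌈(n : ℚ) / 2⌉ - ⌊(n : ℚ) / 2⌋ + 1) * j)

/-! Over F₂, (U + 1)² = U² + 1, so adding the identity matches the square roots of 1 with those of
0. For the other two sets the common count comes from refining by rank: with P_n(x) the sum of x ^
rank U, both sets obey one recurrence (`rankSum_succ`). Border a root U of rank r by a column (v,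
a). The admissible v form a subspace of dimension n - r containing the range of U, and a is
determined by v. The 2^r vectors in the range keep the rank and the other 2^(n-r) - 2^r raise it by
one, so P_(n+1)(x) = (1 - x) P_n(2x) + 2^n x P_n(x/2).

This operator sends a suitably weighted `q`-Fibonacci polynomial to a sum of two neighbours
(`qFib_operator`), so the coefficients of P_n in these polynomials obey Pascal's rule and are ballot
numbers (`rank_recurrence_solution`). At x = 1 the polynomials vanish or are signed powers of 2,
with period three in the index; this produces the steps 3j in the formula. -/

/-! ### `q`-Fibonacci polynomials -/

/-- Rescaled `q`-Fibonacci polynomials at `q = 2`. -/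
def qFib : ℕ → ℚ → ℚ
  | 0, _ => 0
  | 1, _ => 1
  | m + 2, x => qFib (m + 1) (2 * x) - x * qFib m (2 * x)

theorem qFib_add_two (m : ℕ) (x : ℚ) :
    qFib (m + 2) x = qFib (m + 1) (2 * x) - x * qFib m (2 * x) := rfl

/-- `qFib m x` counts tilings of a board of length m - 1 by monominoes and dominoes, a domino
preceded by s tiles having weight -2^s x. The definition removes the first tile; this recurrence
removes the last one. -/
theorem two_mul_qFib_add_two (m : ℕ) : ∀ x : ℚ,
    2 * qFib (m + 2) (2 * x) = 2 * qFib (m + 1) (2 * x) - 2 ^ (m + 1) * x * qFib m x := by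
  induction m using Nat.twoStepInduction with
  | zero => intro x; simp [qFib]
  | one => intro x; simp [qFib]; ring
  | more m h1 h2 =>
    intro x
    have e1 := h2 (2 * x)
    have e2 := h1 (2 * x)
    rw [qFib_add_two (m + 2), qFib_add_two (m + 1) (2 * x), qFib_add_two m x]
    rw [show m + 1 + 2 = m + 2 + 1 from rfl] at e1
    simp only [show m + 1 + 1 = m + 2 from rfl] at *
    linear_combination e1 - 2 * x * e2

/-- The rank-raising operator acts on the `q`-Fibonacci polynomials by a three-term relation. -/
theorem qFib_operator (m : ℕ) (x : ℚ) :
    (1 - x) * qFib (m + 1) (2 * x) + 2 ^ m * x * qFib (m + 1) (x / 2)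
      = qFib (m + 2) x + 2 ^ m * x * qFib m x := by
  rcases m with _ | m
  · simp [qFib]
  · have h := two_mul_qFib_add_two m x
    have e1 := qFib_add_two m (x / 2)
    rw [show 2 * (x / 2) = x by ring] at e1
    rw [qFib_add_two (m + 1) x]
    rw [show m + 1 + 1 = m + 2 from rfl, e1]
    linear_combination (-x / 2) * h

/-- The first-tile recurrence at 1 and the last-tile recurrence both involve values at 2; these
cancel. -/
theorem qFib_one_recurrence (m : ℕ) : qFib (m + 4) 1 = -2 ^ (m + 1) * qFib (m + 1) 1 := by
  have h := two_mul_qFib_add_two (m + 1) 1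
  have e1 := qFib_add_two (m + 2) 1
  simp only [mul_one] at h e1
  rw [e1]
  rw [show m + 1 + 2 = m + 2 + 1 from rfl, show m + 1 + 1 = m + 2 from rfl] at h
  rw [pow_succ] at h ⊢
  linear_combination h / 2

theorem qFib_one_three_mul_add_one (t : ℕ) :
    qFib (3 * t + 1) 1 = (-1) ^ t * (2 : ℚ) ^ ((t : ℤ) * (3 * t - 1) / 2) := by
  induction t with
  | zero => simp [qFib]
  | succ t ih =>
    rw [show 3 * (t + 1) + 1 = 3 * t + 4 by ring, qFib_one_recurrence, ih]
    have : ((t + 1 : ℕ) : ℤ) * (3 * (t + 1 : ℕ) - 1) / 2 = t * (3 * t - 1) / 2 + ((3 * t + 1 : ℕ) : ℤ) := by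
      push_cast
      rw [show ((t : ℤ) + 1) * (3 * (t + 1) - 1) = t * (3 * t - 1) + (3 * t + 1) * 2 by ring,
        Int.add_mul_ediv_right _ _ (by norm_num)]
    rw [this, zpow_add₀ (by norm_num), zpow_natCast]
    ring

theorem qFib_one_three_mul_add_two (t : ℕ) :
    qFib (3 * t + 2) 1 = (-1) ^ t * (2 : ℚ) ^ ((t : ℤ) * (3 * t + 1) / 2) := by
  induction t with
  | zero => simp [qFib]
  | succ t ih =>
    rw [show 3 * (t + 1) + 2 = (3 * t + 1) + 4 by ring, qFib_one_recurrence, ih]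
    have : ((t + 1 : ℕ) : ℤ) * (3 * (t + 1 : ℕ) + 1) / 2 = t * (3 * t + 1) / 2 + ((3 * t + 2 : ℕ) : ℤ) := by
      push_cast
      rw [show ((t : ℤ) + 1) * (3 * (t + 1) + 1) = t * (3 * t + 1) + (3 * t + 2) * 2 by ring,
        Int.add_mul_ediv_right _ _ (by norm_num)]
    rw [this, zpow_add₀ (by norm_num), zpow_natCast]
    ring

theorem qFib_one_three_mul (t : ℕ) : qFib (3 * t) 1 = 0 := by
  induction t with
  | zero => simp [qFib]
  | succ t ih =>
    rcases t with _ | t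
    · norm_num [qFib]
    · rw [show 3 * (t + 1 + 1) = (3 * t + 2) + 4 by ring, qFib_one_recurrence,
        show 3 * t + 2 + 1 = 3 * (t + 1) by ring, ih, mul_zero]

/-! ### Ballot numbers -/

/-- The ballot number `n` over `k` minus `n` over `k - 1`. -/
def ballot (n : ℕ) (k : ℤ) : ℤ := binom n k - binom n (k - 1)

theorem binom_natCast (n k : ℕ) : binom n k = n.choose k := by simp [binom]

theorem binom_of_neg (n : ℕ) {k : ℤ} (hk : k < 0) : binom n k = 0 := by
  simp [binom, not_le.2 hk]

theorem binom_of_gt (n : ℕ) {k : ℤ} (hk : n < k) : binom n k = 0 := by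
  rw [binom, if_pos (by omega), Nat.choose_eq_zero_of_lt (by omega), Nat.cast_zero]

theorem binom_symm (n : ℕ) (k : ℤ) : binom n (n - k) = binom n k := by
  rcases lt_or_ge k 0 with h | h
  · rw [binom_of_neg n h, binom_of_gt n (by omega)]
  rcases lt_or_ge (n : ℤ) k with h' | h'
  · rw [binom_of_gt n h', binom_of_neg n (by omega)]
  lift k to ℕ using h
  have hk : k ≤ n := by omega
  rw [← Nat.cast_sub hk, binom_natCast, binom_natCast, Nat.choose_symm hk]

theorem binom_succ (n : ℕ) (k : ℤ) : binom (n + 1) k = binom n k + binom n (k - 1) := by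
  rcases lt_or_ge k 0 with h | h
  · rw [binom_of_neg _ h, binom_of_neg _ h, binom_of_neg _ (by omega), add_zero]
  lift k to ℕ using h
  rcases k with _ | k
  · simp [binom]
  · rw [show ((k + 1 : ℕ) : ℤ) - 1 = k by push_cast; ring]
    simp only [binom_natCast, Nat.choose_succ_succ]
    push_cast; ring

theorem ballot_reflect (n : ℕ) (k : ℤ) : ballot n (n + 1 - k) = -ballot n k := by
  rw [ballot, ballot, ← binom_symm n k, ← binom_symm n (k - 1)]
  rw [show (n : ℤ) + 1 - k - 1 = n - k by ring, show (n : ℤ) + 1 - k = n - (k - 1) by ring]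
  ring

theorem ballot_succ (n : ℕ) (k : ℤ) : ballot (n + 1) k = ballot n k + ballot n (k - 1) := by
  simp only [ballot, binom_succ]; ring

theorem ballot_of_neg (n : ℕ) {k : ℤ} (hk : k < 0) : ballot n k = 0 := by
  rw [ballot, binom_of_neg n hk, binom_of_neg n (by omega), sub_zero]

theorem ballot_of_gt (n : ℕ) {k : ℤ} (hk : (n : ℤ) + 1 < k) : ballot n k = 0 := by
  rw [ballot, binom_of_gt n (by omega), binom_of_gt n (by omega), sub_zero]

theorem ballot_middle {n : ℕ} {k : ℤ} (h : 2 * k = n + 1) : ballot n k = 0 := by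
  have := ballot_reflect n k
  rw [show (n : ℤ) + 1 - k = k by omega] at this
  omega

/-! ### Solving the rank recurrence -/

/-- The solution of the rank recurrence, in terms of ballot numbers. -/
theorem rank_recurrence_solution (P : ℕ → ℚ → ℚ) (h0 : ∀ x, P 0 x = 1)
    (hP : ∀ n x, P (n + 1) x = (1 - x) * P n (2 * x) + 2 ^ n * x * P n (x / 2)) (n : ℕ) :
    ∀ x, P n x = ∑ k ∈ Finset.range (n + 1),
      (ballot n k : ℚ) * 2 ^ (k * (n - k)) * x ^ k * qFib (n + 1 - 2 * k) x := by
  induction n with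
  | zero => intro x; simp [h0, qFib, ballot, binom]
  | succ n ih =>
    intro x
    have step : ∀ k ∈ Finset.range (n + 1),
        (1 - x) * ((ballot n k : ℚ) * 2 ^ (k * (n - k)) * (2 * x) ^ k * qFib (n + 1 - 2 * k) (2 * x))
          + 2 ^ n * x * ((ballot n k : ℚ) * 2 ^ (k * (n - k)) * (x / 2) ^ k *
            qFib (n + 1 - 2 * k) (x / 2)) =
        (ballot n k : ℚ) * 2 ^ (k * (n + 1 - k)) * x ^ k * qFib (n + 2 - 2 * k) x +
        (ballot n k : ℚ) * 2 ^ ((k + 1) * (n - k)) * x ^ (k + 1) * qFib (n + 2 - 2 * (k + 1)) x := by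
      intro k hk
      have hk' : k ≤ n := by simpa [Nat.lt_succ_iff] using hk
      -- Below the middle this is `qFib_operator`. At 2k = n + 1 the factor `qFib 1` on the right is
      -- nonzero, so the vanishing of the ballot number is needed. Beyond it, truncated subtraction
      -- makes every index 0.
      rcases lt_trichotomy (2 * k) (n + 1) with h | h | h
      · obtain ⟨m, rfl⟩ : ∃ m, n = 2 * k + m := ⟨n - 2 * k, by omega⟩
        have key := qFib_operator m x
        rw [show 2 * k + m + 1 - 2 * k = m + 1 by omega, show 2 * k + m + 2 - 2 * k = m + 2 by omega,
          show 2 * k + m + 2 - 2 * (k + 1) = m by omega, show 2 * k + m - k = k + m by omega,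
          show 2 * k + m + 1 - k = k + m + 1 by omega]
        rw [mul_pow, div_pow]
        have e1 : (2 : ℚ) ^ (k * (k + m + 1)) = 2 ^ (k * (k + m)) * 2 ^ k := by ring
        have e2 : (2 : ℚ) ^ ((k + 1) * (k + m)) = 2 ^ (k * (k + m)) * 2 ^ k * 2 ^ m := by ring
        have e3 : (2 : ℚ) ^ (2 * k + m) = 2 ^ k * 2 ^ k * 2 ^ m := by ring
        rw [e1, e2, e3, pow_succ x k]
        have e4 : (2 : ℚ) ^ k * (x ^ k / 2 ^ k) = x ^ k := by field_simp
        linear_combination (ballot (2 * k + m) k : ℚ) * 2 ^ (k * (k + m)) * 2 ^ k * x ^ k * key +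
          (2 ^ k * 2 ^ m * x * ballot (2 * k + m) k * 2 ^ (k * (k + m)) * qFib (m + 1) (x / 2)) * e4
      · rw [ballot_middle (by exact_mod_cast h)]; simp
      · rw [show n + 1 - 2 * k = 0 by omega, show n + 2 - 2 * k = 0 by omega,
          show n + 2 - 2 * (k + 1) = 0 by omega]
        simp [qFib]
    rw [hP, ih, ih, Finset.mul_sum, Finset.mul_sum, ← Finset.sum_add_distrib,
      Finset.sum_congr rfl step, Finset.sum_add_distrib]
    -- Pascal's rule splits each new coefficient into the contributions of the old terms k and k -
    -- 1.
    have split : ∀ k ∈ Finset.range (n + 1 + 1),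
        (ballot (n + 1) k : ℚ) * 2 ^ (k * (n + 1 - k)) * x ^ k * qFib (n + 1 + 1 - 2 * k) x =
        (ballot n k : ℚ) * 2 ^ (k * (n + 1 - k)) * x ^ k * qFib (n + 2 - 2 * k) x +
        (ballot n (k - 1) : ℚ) * 2 ^ (k * (n + 1 - k)) * x ^ k * qFib (n + 2 - 2 * k) x := by
      intro k _
      rw [ballot_succ]; push_cast; ring
    rw [Finset.sum_congr rfl split, Finset.sum_add_distrib, Finset.sum_range_succ _ (n + 1),
      Finset.sum_range_succ' _ (n + 1)]
    have z1 : qFib (n + 2 - 2 * (n + 1)) x = 0 := by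
      rw [show n + 2 - 2 * (n + 1) = 0 by omega]; rfl
    have z2 : ballot n (((0 : ℕ) : ℤ) - 1) = 0 := ballot_of_neg n (by simp)
    rw [z1, z2]
    simp only [Nat.add_sub_add_right, Nat.cast_add, Nat.cast_one, add_sub_cancel_right]
    ring

/-! ### Evaluation at x = 1 -/

theorem floor_half (n : ℕ) : ⌊(n : ℚ) / 2⌋ = ((n / 2 : ℕ) : ℤ) := by
  simpa using Rat.floor_intCast_div_natCast (n : ℤ) 2

theorem ceil_half (n : ℕ) : ⌈(n : ℚ) / 2⌉ = ((n - n / 2 : ℕ) : ℤ) := by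
  rw [Int.ceil_eq_iff]
  rcases Nat.even_or_odd' n with ⟨N, rfl | rfl⟩
  · rw [show 2 * N - 2 * N / 2 = N by omega]; push_cast; constructor <;> linarith
  · rw [show 2 * N + 1 - (2 * N + 1) / 2 = N + 1 by omega]; push_cast; constructor <;> linarith

theorem countTerm_eq (n : ℕ) (j : ℤ) :
    countTerm n j = (ballot n ((n / 2 : ℕ) - 3 * j) : ℚ) *
      2 ^ (((n / 2 : ℕ) : ℤ) * (n - n / 2 : ℕ) - 3 * j ^ 2 -
        (((n - n / 2 : ℕ) : ℤ) - (n / 2 : ℕ) + 1) * j) := by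
  rw [countTerm, floor_half, ceil_half, ballot]

theorem countTerm_eq_zero {n : ℕ} {j : ℤ} (hj : j ∉ Finset.Ico (-(n + 1) : ℤ) (n + 1)) :
    countTerm n j = 0 := by
  have hb : ballot n ((n / 2 : ℕ) - 3 * j) = 0 := by
    simp only [Finset.mem_Ico, not_and_or, not_le, not_lt] at hj
    rcases hj with h | h
    · exact ballot_of_gt n (by omega)
    · exact ballot_of_neg n (by omega)
  rw [countTerm_eq, hb]
  simp

theorem support_countTerm_subset (n : ℕ) :
    Function.support (countTerm n) ⊆ Finset.Ico (-(n + 1) : ℤ) (n + 1) := by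
  intro j hj
  by_contra h
  exact hj (countTerm_eq_zero h)

theorem sum_Ico_neg_eq {M : Type*} [AddCommMonoid M] (f : ℤ → M) (N : ℕ) :
    ∑ j ∈ Finset.Ico (-N : ℤ) N, f j =
      ∑ i ∈ Finset.range N, (f i + f (-(i + 1))) := by
  induction N with
  | zero => simp
  | succ N ih =>
    rw [Finset.sum_range_succ, ← ih]
    have : Finset.Ico (-(N + 1 : ℕ) : ℤ) ((N + 1 : ℕ) : ℤ) =
        insert (N : ℤ) (insert (-(N + 1) : ℤ) (Finset.Ico (-N : ℤ) N)) := by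
      ext j; simp only [Finset.mem_Ico, Finset.mem_insert]; omega
    rw [this, Finset.sum_insert, Finset.sum_insert]
    · rw [← add_assoc, add_comm]
    · simp
    · simp only [Finset.mem_Ico, Finset.mem_insert]; omega

theorem sum_range_three_mul {M : Type*} [AddCommMonoid M] (f : ℕ → M) (N : ℕ) :
    ∑ l ∈ Finset.range (3 * N), f l =
      ∑ i ∈ Finset.range N, (f (3 * i) + f (3 * i + 1) + f (3 * i + 2)) := by
  induction N with
  | zero => simp
  | succ N ih =>
    rw [show 3 * (N + 1) = 3 * N + 1 + 1 + 1 by ring, Finset.sum_range_succ, Finset.sum_range_succ,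
      Finset.sum_range_succ, ih, Finset.sum_range_succ, add_assoc, add_assoc, add_assoc]

theorem finsum_countTerm (n : ℕ) :
    ∑ᶠ j : ℤ, countTerm n j =
      ∑ i ∈ Finset.range (n + 1), (countTerm n i + countTerm n (-(i + 1))) := by
  rw [finsum_eq_sum_of_support_subset _ (support_countTerm_subset n)]
  exact_mod_cast sum_Ico_neg_eq (countTerm n) (n + 1)

/-- The terms of the solution of the rank recurrence at `1`, indexed from the middle. -/
def middleTerm (n l : ℕ) : ℚ :=
  (ballot n ((n / 2 : ℕ) - l) : ℚ) * 2 ^ (((n / 2 : ℕ) - l : ℤ) * (n - ((n / 2 : ℕ) - l))) *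
    qFib (n % 2 + 2 * l + 1) 1

theorem sum_eq_sum_middleTerm (n : ℕ) :
    ∑ k ∈ Finset.range (n + 1),
      (ballot n k : ℚ) * 2 ^ (k * (n - k)) * 1 ^ k * qFib (n + 1 - 2 * k) 1 =
    ∑ l ∈ Finset.range (3 * (n + 1)), middleTerm n l := by
  have h1 : ∑ k ∈ Finset.range (n / 2 + 1),
      (ballot n k : ℚ) * 2 ^ (k * (n - k)) * 1 ^ k * qFib (n + 1 - 2 * k) 1 =
      ∑ k ∈ Finset.range (n + 1),
      (ballot n k : ℚ) * 2 ^ (k * (n - k)) * 1 ^ k * qFib (n + 1 - 2 * k) 1 := by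
    apply Finset.sum_subset
    · intro k; simp only [Finset.mem_range]; omega
    · intro k _ hk
      simp only [Finset.mem_range] at hk
      rw [show n + 1 - 2 * k = 0 by omega]; simp [qFib]
  have h2 : ∑ l ∈ Finset.range (n / 2 + 1), middleTerm n l =
      ∑ l ∈ Finset.range (3 * (n + 1)), middleTerm n l := by
    apply Finset.sum_subset
    · intro k; simp only [Finset.mem_range]; omega
    · intro l _ hl
      simp only [Finset.mem_range] at hl
      rw [middleTerm, ballot_of_neg n (by omega)]; simp
  rw [← h1, ← h2, ← Finset.sum_range_reflect]
  apply Finset.sum_congr rfl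
  intro l hl
  have hl' : l ≤ n / 2 := by simpa [Nat.lt_succ_iff] using hl
  rw [show n / 2 + 1 - 1 - l = n / 2 - l by omega, middleTerm,
    show n + 1 - 2 * (n / 2 - l) = n % 2 + 2 * l + 1 by omega, ← Nat.cast_sub hl',
    ← Nat.cast_sub (show n / 2 - l ≤ n by omega), ← Nat.cast_mul, zpow_natCast, one_pow, mul_one]

/-- Of three consecutive indices one has a factor `qFib (3 * t) 1 = 0`, and one is the term j = i.
The last becomes the term j = -(i + 1) after reflecting the ballot number; the sign of the
reflection cancels the factor (-1)^(2i+1). The parity of n decides which index vanishes. -/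
theorem middleTerm_add_middleTerm_add_middleTerm (n i : ℕ) :
    middleTerm n (3 * i) + middleTerm n (3 * i + 1) + middleTerm n (3 * i + 2) =
      countTerm n i + countTerm n (-(i + 1)) := by
  simp only [countTerm_eq, middleTerm]
  rcases Nat.even_or_odd' n with ⟨N, rfl | rfl⟩
  · rw [show 2 * N - 2 * N / 2 = N by omega, show 2 * N / 2 = N by omega]
    have a0 := qFib_one_three_mul_add_one (2 * i)
    have a1 := qFib_one_three_mul (2 * i + 1)
    have a2 := qFib_one_three_mul_add_two (2 * i + 1)
    have b := ballot_reflect (2 * N) (N - 3 * -((i : ℤ) + 1))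
    rw [show 2 * N % 2 + 2 * (3 * i) + 1 = 3 * (2 * i) + 1 by omega,
      show 2 * N % 2 + 2 * (3 * i + 1) + 1 = 3 * (2 * i + 1) by omega,
      show 2 * N % 2 + 2 * (3 * i + 2) + 1 = 3 * (2 * i + 1) + 2 by omega, a0, a1, a2]
    rw [show ((2 * i : ℕ) : ℤ) * (3 * (2 * i : ℕ) - 1) / 2 = i * (6 * i - 1) by
        rw [Int.ediv_eq_iff_eq_mul_left (by norm_num) (Dvd.intro (i * (6 * i - 1) : ℤ) (by push_cast; ring))]
        push_cast; ring,
      show ((2 * i + 1 : ℕ) : ℤ) * (3 * (2 * i + 1 : ℕ) + 1) / 2 = (2 * i + 1) * (3 * i + 2) by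
        rw [Int.ediv_eq_iff_eq_mul_left (by norm_num)
          (Dvd.intro ((2 * i + 1) * (3 * i + 2) : ℤ) (by push_cast; ring))]
        push_cast; ring]
    have b' : ballot (2 * N) (N - 3 * -((i : ℤ) + 1)) =
        -ballot (2 * N) (N - ((3 * i + 2 : ℕ) : ℤ)) := by
      rw [← neg_neg (ballot (2 * N) (N - 3 * -((i : ℤ) + 1))), ← b]
      congr 2; push_cast; ring
    rw [b']
    rw [(even_two_mul i).neg_one_pow, (odd_two_mul_add_one i).neg_one_pow]
    simp only [one_mul, mul_zero, add_zero, mul_assoc]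
    rw [mul_left_comm _ (-1 : ℚ), ← zpow_add₀ (by norm_num), ← zpow_add₀ (by norm_num)]
    push_cast
    rw [neg_one_mul, mul_neg, neg_mul]
    congr 1
    · congr 2; ring
    · congr 3; ring
  · rw [show 2 * N + 1 - (2 * N + 1) / 2 = N + 1 by omega, show (2 * N + 1) / 2 = N by omega]
    have a0 := qFib_one_three_mul_add_two (2 * i)
    have a1 := qFib_one_three_mul_add_one (2 * i + 1)
    have a2 := qFib_one_three_mul (2 * i + 2)
    have b := ballot_reflect (2 * N + 1) (N - 3 * -((i : ℤ) + 1))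
    rw [show (2 * N + 1) % 2 + 2 * (3 * i) + 1 = 3 * (2 * i) + 2 by omega,
      show (2 * N + 1) % 2 + 2 * (3 * i + 1) + 1 = 3 * (2 * i + 1) + 1 by omega,
      show (2 * N + 1) % 2 + 2 * (3 * i + 2) + 1 = 3 * (2 * i + 2) by omega, a0, a1, a2]
    rw [show ((2 * i : ℕ) : ℤ) * (3 * (2 * i : ℕ) + 1) / 2 = i * (6 * i + 1) by
        rw [Int.ediv_eq_iff_eq_mul_left (by norm_num) (Dvd.intro (i * (6 * i + 1) : ℤ) (by push_cast; ring))]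
        push_cast; ring,
      show ((2 * i + 1 : ℕ) : ℤ) * (3 * (2 * i + 1 : ℕ) - 1) / 2 = (2 * i + 1) * (3 * i + 1) by
        rw [Int.ediv_eq_iff_eq_mul_left (by norm_num)
          (Dvd.intro ((2 * i + 1) * (3 * i + 1) : ℤ) (by push_cast; ring))]
        push_cast; ring]
    have b' : ballot (2 * N + 1) (N - 3 * -((i : ℤ) + 1)) =
        -ballot (2 * N + 1) (N - ((3 * i + 1 : ℕ) : ℤ)) := by
      rw [← neg_neg (ballot (2 * N + 1) (N - 3 * -((i : ℤ) + 1))), ← b]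
      congr 2; push_cast; ring
    rw [b']
    rw [(even_two_mul i).neg_one_pow, (odd_two_mul_add_one i).neg_one_pow]
    simp only [one_mul, mul_zero, add_zero, mul_assoc]
    rw [mul_left_comm _ (-1 : ℚ), ← zpow_add₀ (by norm_num), ← zpow_add₀ (by norm_num)]
    push_cast
    rw [neg_one_mul, mul_neg, neg_mul]
    congr 1
    · congr 2; ring
    · congr 3; ring

theorem eq_finsum_countTerm (P : ℕ → ℚ → ℚ) (h0 : ∀ x, P 0 x = 1)
    (hP : ∀ n x, P (n + 1) x = (1 - x) * P n (2 * x) + 2 ^ n * x * P n (x / 2)) (n : ℕ) :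
    P n 1 = ∑ᶠ j : ℤ, countTerm n j := by
  rw [rank_recurrence_solution P h0 hP, sum_eq_sum_middleTerm, sum_range_three_mul,
    finsum_countTerm]
  exact Finset.sum_congr rfl fun i _ => middleTerm_add_middleTerm_add_middleTerm n i

/-! ### Bordering a triangular matrix by a column -/

/-- The matrix obtained from `U` by adding the last column `(v, a)` and completing the last row
by zeros. -/
def extendMatrix {n : ℕ} {K : Type*} [Zero K] (U : Matrix (Fin n) (Fin n) K) (v : Fin n → K)
    (a : K) : Matrix (Fin (n + 1)) (Fin (n + 1)) K :=
  Matrix.of (Fin.snoc (α := fun _ => Fin (n + 1) → K)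
    (fun i => Fin.snoc (α := fun _ => K) (U i) (v i)) (Fin.snoc (α := fun _ => K) 0 a))

section extendMatrix

variable {n : ℕ} {K : Type*}

@[simp] theorem extendMatrix_castSucc_castSucc [Zero K] (U : Matrix (Fin n) (Fin n) K)
    (v : Fin n → K) (a : K) (i j : Fin n) :
    extendMatrix U v a i.castSucc j.castSucc = U i j := by
  simp [extendMatrix]

@[simp] theorem extendMatrix_castSucc_last [Zero K] (U : Matrix (Fin n) (Fin n) K)
    (v : Fin n → K) (a : K) (i : Fin n) : extendMatrix U v a i.castSucc (Fin.last n) = v i := by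
  simp [extendMatrix]

@[simp] theorem extendMatrix_last_castSucc [Zero K] (U : Matrix (Fin n) (Fin n) K)
    (v : Fin n → K) (a : K) (j : Fin n) : extendMatrix U v a (Fin.last n) j.castSucc = 0 := by
  simp [extendMatrix]

@[simp] theorem extendMatrix_last_last [Zero K] (U : Matrix (Fin n) (Fin n) K)
    (v : Fin n → K) (a : K) : extendMatrix U v a (Fin.last n) (Fin.last n) = a := by
  simp [extendMatrix]

theorem extendMatrix_isUpperTriangular_iff [Zero K] {U : Matrix (Fin n) (Fin n) K}
    {v : Fin n → K} {a : K} :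
    (extendMatrix U v a).IsUpperTriangular ↔ U.IsUpperTriangular := by
  constructor
  · intro h i j hij
    have := h (show id j.castSucc < id i.castSucc from hij)
    simpa using this
  · intro h i j hij
    refine Fin.lastCases (fun hij => ?_) (fun i hij => ?_) i hij
    · refine Fin.lastCases (fun hij => ?_) (fun j _ => ?_) j hij
      · exact absurd hij (lt_irrefl _)
      · simp
    · refine Fin.lastCases (fun hij => ?_) (fun j hij => ?_) j hij
      · exact absurd hij (not_lt.2 (Fin.le_last _))
      · rw [extendMatrix_castSucc_castSucc]; exact h hij

theorem exists_extendMatrix_eq [Zero K] {M : Matrix (Fin (n + 1)) (Fin (n + 1)) K}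
    (hM : M.IsUpperTriangular) : ∃ U v a, M = extendMatrix U v a := by
  refine ⟨Matrix.of fun i j => M i.castSucc j.castSucc, fun i => M i.castSucc (Fin.last n),
    M (Fin.last n) (Fin.last n), ?_⟩
  ext i j
  refine Fin.lastCases ?_ (fun i => ?_) i <;> refine Fin.lastCases ?_ (fun j => ?_) j
  · simp
  · rw [extendMatrix_last_castSucc]; exact hM (Fin.castSucc_lt_last j)
  · simp
  · simp

theorem extendMatrix_inj [Zero K] {U U' : Matrix (Fin n) (Fin n) K} {v v' : Fin n → K} {a a' : K} :
    extendMatrix U v a = extendMatrix U' v' a' ↔ U = U' ∧ v = v' ∧ a = a' := by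
  refine ⟨fun h => ⟨?_, ?_, ?_⟩, by rintro ⟨rfl, rfl, rfl⟩; rfl⟩
  · ext i j; simpa using congrFun₂ h i.castSucc j.castSucc
  · ext i; simpa using congrFun₂ h i.castSucc (Fin.last n)
  · simpa using congrFun₂ h (Fin.last n) (Fin.last n)

theorem extendMatrix_sq_eq_zero_iff [Field K] {U : Matrix (Fin n) (Fin n) K}
    {v : Fin n → K} {a : K} :
    extendMatrix U v a ^ 2 = 0 ↔ U ^ 2 = 0 ∧ U.mulVec v = 0 ∧ a = 0 := by
  have key : extendMatrix U v a ^ 2 = extendMatrix (U ^ 2) (U.mulVec v + a • v) (a * a) := by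
    ext i j
    rw [sq, sq, Matrix.mul_apply, Fin.sum_univ_castSucc]
    refine Fin.lastCases ?_ (fun i => ?_) i <;> refine Fin.lastCases ?_ (fun j => ?_) j <;>
      simp [Matrix.mul_apply, Matrix.mulVec, dotProduct, mul_comm]
  have zero : (0 : Matrix (Fin (n + 1)) (Fin (n + 1)) K) = extendMatrix 0 0 0 := by
    ext i j
    refine Fin.lastCases ?_ (fun i => ?_) i <;> refine Fin.lastCases ?_ (fun j => ?_) j <;> simp
  rw [key, zero, extendMatrix_inj]
  constructor
  · rintro ⟨h1, h2, h3⟩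
    have ha := mul_self_eq_zero.1 h3
    exact ⟨h1, by simpa [ha] using h2, ha⟩
  · rintro ⟨h1, h2, rfl⟩
    exact ⟨h1, by simpa using h2, by simp⟩

theorem extendMatrix_transpose_mul_self_eq_zero_iff [CommRing K] {U : Matrix (Fin n) (Fin n) K}
    {v : Fin n → K} {a : K} :
    (extendMatrix U v a).transpose * extendMatrix U v a = 0 ↔
      U.transpose * U = 0 ∧ U.transpose.mulVec v = 0 ∧ v ⬝ᵥ v + a * a = 0 := by
  rw [← Matrix.ext_iff]
  simp only [Fin.forall_fin_succ', Matrix.mul_apply, Fin.sum_univ_castSucc,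
    Matrix.transpose_apply, extendMatrix_castSucc_castSucc, extendMatrix_castSucc_last,
    extendMatrix_last_castSucc, extendMatrix_last_last, mul_zero, zero_mul, add_zero,
    Matrix.zero_apply]
  constructor
  · rintro ⟨h1, h2, h3⟩
    refine ⟨?_, ?_, h3⟩
    · ext i j; simpa [Matrix.mul_apply] using (h1 i).1 j
    · ext i; simpa [Matrix.mulVec, dotProduct] using (h1 i).2
  · rintro ⟨h1, h2, h3⟩
    refine ⟨fun i => ⟨fun j => ?_, ?_⟩, fun i => ?_, h3⟩
    · simpa [Matrix.mul_apply] using congrFun₂ h1 i j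
    · simpa [Matrix.mulVec, dotProduct] using congrFun h2 i
    · simpa [Matrix.mulVec, dotProduct, mul_comm] using congrFun h2 i

/-- Appending a zero coordinate, as a linear map. -/
def snocZero (n : ℕ) (K : Type*) [Semiring K] : (Fin n → K) →ₗ[K] (Fin (n + 1) → K) where
  toFun v := Fin.snoc (α := fun _ => K) v 0
  map_add' v w := by
    ext i; refine Fin.lastCases ?_ (fun i => ?_) i <;> simp
  map_smul' c v := by
    ext i; refine Fin.lastCases ?_ (fun i => ?_) i <;> simp

theorem snocZero_injective (n : ℕ) (K : Type*) [Semiring K] :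
    Function.Injective (snocZero n K) := by
  intro v w h
  ext i
  simpa [snocZero] using congrFun h i.castSucc

theorem range_mulVecLin_extendMatrix [Field K] (U : Matrix (Fin n) (Fin n) K) (v : Fin n → K)
    (a : K) : LinearMap.range (extendMatrix U v a).mulVecLin =
      (LinearMap.range U.mulVecLin).map (snocZero n K) ⊔
        Submodule.span K {(Fin.snoc v a : Fin (n + 1) → K)} := by
  have key : ∀ (w : Fin n → K) (b : K),
      (extendMatrix U v a).mulVec (Fin.snoc w b : Fin (n + 1) → K) =
        snocZero n K (U.mulVec w) + b • (Fin.snoc v a : Fin (n + 1) → K) := by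
    intro w b
    ext i
    refine Fin.lastCases ?_ (fun i => ?_) i <;>
      simp [Matrix.mulVec, dotProduct, Fin.sum_univ_castSucc, snocZero, mul_comm]
  ext y
  simp only [Submodule.mem_sup, Submodule.mem_map, LinearMap.mem_range, Matrix.mulVecLin_apply,
    Submodule.mem_span_singleton]
  constructor
  · rintro ⟨w, rfl⟩
    refine ⟨_, ⟨_, ⟨Fin.init w, rfl⟩, rfl⟩, _, ⟨w (Fin.last n), rfl⟩, ?_⟩
    rw [← key, Fin.snoc_init_self]
  · rintro ⟨_, ⟨_, ⟨w, rfl⟩, rfl⟩, _, ⟨b, rfl⟩, rfl⟩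
    exact ⟨_, key w b⟩

theorem rank_extendMatrix_of_mem [Field K] {U : Matrix (Fin n) (Fin n) K} {v : Fin n → K}
    (hv : v ∈ LinearMap.range U.mulVecLin) : (extendMatrix U v 0).rank = U.rank := by
  rw [Matrix.rank, range_mulVecLin_extendMatrix, sup_eq_left.2,
    (Submodule.equivMapOfInjective _ (snocZero_injective n K) _).symm.finrank_eq, Matrix.rank]
  rw [Submodule.span_singleton_le_iff_mem]
  exact Submodule.mem_map_of_mem (f := snocZero n K) hv

theorem rank_extendMatrix_of_notMem [Field K] {U : Matrix (Fin n) (Fin n) K} {v : Fin n → K}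
    (a : K) (hv : v ∉ LinearMap.range U.mulVecLin) : (extendMatrix U v a).rank = U.rank + 1 := by
  have hy : (Fin.snoc v a : Fin (n + 1) → K) ∉
      (LinearMap.range U.mulVecLin).map (snocZero n K) := by
    rintro ⟨w, hw, h⟩
    have : w = v := by
      ext i
      simpa [snocZero] using congrFun h i.castSucc
    exact hv (this ▸ hw)
  rw [Matrix.rank, range_mulVecLin_extendMatrix, Submodule.finrank_sup_span_singleton hy,
    (Submodule.equivMapOfInjective _ (snocZero_injective n K) _).symm.finrank_eq, Matrix.rank]

end extendMatrix

/-! ### The rank recurrence -/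

/-- The generating function of the rank on a set of matrices. -/
noncomputable def rankSum {n : ℕ} (S : Set (Matrix (Fin n) (Fin n) (ZMod 2))) (x : ℚ) : ℚ :=
  ∑ U ∈ S.toFinite.toFinset, x ^ U.rank

theorem rankSum_one {n : ℕ} (S : Set (Matrix (Fin n) (Fin n) (ZMod 2))) :
    rankSum S 1 = S.ncard := by
  rw [rankSum, Set.ncard_eq_toFinset_card S]
  simp

theorem card_submodule_zmod_two {n : ℕ} (W : Submodule (ZMod 2) (Fin n → ZMod 2)) :
    (W : Set (Fin n → ZMod 2)).toFinite.toFinset.card = 2 ^ Module.finrank (ZMod 2) W := by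
  rw [← Set.ncard_eq_toFinset_card, ← Nat.card_coe_set_eq]
  simpa using Module.natCard_eq_pow_finrank (K := ZMod 2) (V := W)

/-- `W U` is the space of admissible columns and `α` the forced corner entry. A column outside the
range raises the rank whatever the corner is; one inside keeps it only because `hα` makes the corner
0. The factors 2^r and 2^(n-r) are absorbed by evaluating at 2x and x/2. -/
theorem rankSum_succ {n : ℕ} (S : Set (Matrix (Fin n) (Fin n) (ZMod 2)))
    (S' : Set (Matrix (Fin (n + 1)) (Fin (n + 1)) (ZMod 2)))
    (W : Matrix (Fin n) (Fin n) (ZMod 2) → Submodule (ZMod 2) (Fin n → ZMod 2))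
    (α : (Fin n → ZMod 2) → ZMod 2)
    (hS' : ∀ M, M ∈ S' ↔ ∃ U ∈ S, ∃ v ∈ W U, extendMatrix U v (α v) = M)
    (hrange : ∀ U ∈ S, LinearMap.range U.mulVecLin ≤ W U)
    (hfinrank : ∀ U ∈ S, U.rank + Module.finrank (ZMod 2) (W U) = n)
    (hα : ∀ U ∈ S, ∀ v ∈ LinearMap.range U.mulVecLin, α v = 0) (x : ℚ) :
    rankSum S' x = (1 - x) * rankSum S (2 * x) + 2 ^ n * x * rankSum S (x / 2) := by
  classical
  have himage : S'.toFinite.toFinset =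
      (S.toFinite.toFinset.sigma fun U => (W U : Set (Fin n → ZMod 2)).toFinite.toFinset).image
        fun p => extendMatrix p.1 p.2 (α p.2) := by
    ext M
    simp only [Set.Finite.mem_toFinset, hS', Finset.mem_image, Finset.mem_sigma, Sigma.exists,
      SetLike.mem_coe]
    constructor
    · rintro ⟨U, hU, v, hv, h⟩; exact ⟨U, v, ⟨hU, hv⟩, h⟩
    · rintro ⟨U, v, ⟨hU, hv⟩, h⟩; exact ⟨U, hU, v, hv, h⟩
  rw [rankSum, himage, Finset.sum_image, Finset.sum_sigma, rankSum, rankSum, Finset.mul_sum,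
    Finset.mul_sum, ← Finset.sum_add_distrib]
  · refine Finset.sum_congr rfl fun U hU => ?_
    rw [Set.Finite.mem_toFinset] at hU
    set R : Submodule (ZMod 2) (Fin n → ZMod 2) := LinearMap.range U.mulVecLin with hR
    have hsub : (R : Set (Fin n → ZMod 2)).toFinite.toFinset ⊆
        (W U : Set (Fin n → ZMod 2)).toFinite.toFinset := by
      intro v hv
      rw [Set.Finite.mem_toFinset] at hv ⊢
      exact hrange U hU hv
    have hcR := card_submodule_zmod_two R
    have hcW := card_submodule_zmod_two (W U)
    have hcR' : (R : Set (Fin n → ZMod 2)).toFinite.toFinset.card = 2 ^ U.rank := hcR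
    rw [← Finset.sum_sdiff hsub,
      Finset.sum_congr rfl (g := fun _ => x ^ (U.rank + 1)) (fun v hv => by
        simp only [Finset.mem_sdiff, Set.Finite.mem_toFinset, SetLike.mem_coe] at hv
        rw [rank_extendMatrix_of_notMem _ hv.2]),
      Finset.sum_congr (s₁ := (R : Set (Fin n → ZMod 2)).toFinite.toFinset) rfl
        (g := fun _ => x ^ U.rank) (fun v hv => by
        simp only [Set.Finite.mem_toFinset, SetLike.mem_coe] at hv
        simp only [hα U hU v hv]
        rw [rank_extendMatrix_of_mem hv]),
      Finset.sum_const, Finset.sum_const, Finset.card_sdiff_of_subset hsub, nsmul_eq_mul,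
      nsmul_eq_mul, Nat.cast_sub (Finset.card_le_card hsub), hcR', hcW]
    have hpow : (2 : ℚ) ^ n = 2 ^ U.rank * 2 ^ Module.finrank (ZMod 2) (W U) := by
      rw [← pow_add, hfinrank U hU]
    rw [hpow, mul_pow, div_pow]
    push_cast
    field_simp
    ring
  · rintro ⟨U, v⟩ - ⟨U', v'⟩ - h
    obtain ⟨rfl, rfl, -⟩ := extendMatrix_inj.1 h
    rfl

theorem rankSum_zero_dim {S : Set (Matrix (Fin 0) (Fin 0) (ZMod 2))} (h : 0 ∈ S) (x : ℚ) :
    rankSum S x = 1 := by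
  have : S.toFinite.toFinset = {0} := by
    ext M
    simp only [Set.Finite.mem_toFinset, Finset.mem_singleton]
    exact ⟨fun _ => Subsingleton.elim _ _, fun hM => hM ▸ h⟩
  rw [rankSum, this, Finset.sum_singleton, Matrix.rank_zero, pow_zero]

/-! ### The three sets of matrices -/

theorem rankSum_setB_succ (n : ℕ) (x : ℚ) :
    rankSum (setB (n + 1)) x =
      (1 - x) * rankSum (setB n) (2 * x) + 2 ^ n * x * rankSum (setB n) (x / 2) := by
  refine rankSum_succ _ _ (fun U => LinearMap.ker U.mulVecLin) (fun _ => 0) ?_ ?_ ?_ ?_ x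
  · intro M
    constructor
    · rintro ⟨hM, hM2⟩
      obtain ⟨U, v, a, rfl⟩ := exists_extendMatrix_eq hM
      obtain ⟨h1, h2, rfl⟩ := extendMatrix_sq_eq_zero_iff.1 hM2
      exact ⟨U, ⟨extendMatrix_isUpperTriangular_iff.1 hM, h1⟩, v, h2, rfl⟩
    · rintro ⟨U, ⟨hU, hU2⟩, v, hv, rfl⟩
      exact ⟨extendMatrix_isUpperTriangular_iff.2 hU,
        extendMatrix_sq_eq_zero_iff.2 ⟨hU2, hv, rfl⟩⟩
  · rintro U ⟨-, hU⟩ _ ⟨w, rfl⟩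
    simp [Matrix.mulVec_mulVec, ← sq, hU]
  · intro U _
    simpa [Matrix.rank] using U.mulVecLin.finrank_range_add_finrank_ker
  · intros; rfl

theorem rankSum_setC_succ (n : ℕ) (x : ℚ) :
    rankSum (setC (n + 1)) x =
      (1 - x) * rankSum (setC n) (2 * x) + 2 ^ n * x * rankSum (setC n) (x / 2) := by
  -- Since a² = a in F₂, the corner equation v ⬝ v + a² = 0 has the unique solution a = v ⬝ v.
  have hsq : ∀ a b : ZMod 2, b + a * a = 0 ↔ a = b := by decide
  refine rankSum_succ _ _ (fun U => LinearMap.ker U.transpose.mulVecLin) (fun v => v ⬝ᵥ v)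
    ?_ ?_ ?_ ?_ x
  · intro M
    constructor
    · rintro ⟨hM, hM2⟩
      obtain ⟨U, v, a, rfl⟩ := exists_extendMatrix_eq hM
      obtain ⟨h1, h2, h3⟩ := extendMatrix_transpose_mul_self_eq_zero_iff.1 hM2
      obtain rfl := (hsq _ _).1 h3
      exact ⟨U, ⟨extendMatrix_isUpperTriangular_iff.1 hM, h1⟩, v, h2, rfl⟩
    · rintro ⟨U, ⟨hU, hU2⟩, v, hv, rfl⟩
      exact ⟨extendMatrix_isUpperTriangular_iff.2 hU,
        extendMatrix_transpose_mul_self_eq_zero_iff.2 ⟨hU2, hv, (hsq _ _).2 rfl⟩⟩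
  · rintro U ⟨-, hU⟩ _ ⟨w, rfl⟩
    rw [LinearMap.mem_ker, Matrix.mulVecLin_apply, Matrix.mulVecLin_apply, Matrix.mulVec_mulVec, hU,
      Matrix.zero_mulVec]
  · intro U _
    have := U.transpose.mulVecLin.finrank_range_add_finrank_ker
    rw [← Matrix.rank_transpose U, Matrix.rank]
    simpa using this
  · rintro U ⟨-, hU⟩ _ ⟨w, rfl⟩
    simp only [Matrix.mulVecLin_apply]
    -- For v = Uw, v ⬝ v = wᵀ(UᵀU)w = 0.
    rw [Matrix.dotProduct_mulVec, Matrix.vecMul_mulVec, hU]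
    simp

theorem ncard_setA_eq_ncard_setB (n : ℕ) : (setA n).ncard = (setB n).ncard := by
  have h2 : (2 : Matrix (Fin n) (Fin n) (ZMod 2)) = 0 := by
    ext i j
    rw [← Matrix.diagonal_ofNat]
    simp [Matrix.diagonal_apply, CharTwo.two_eq_zero]
  have himage : setB n = (fun U => U + 1) '' setA n := by
    ext U
    have hone : (1 : Matrix (Fin n) (Fin n) (ZMod 2)).IsUpperTriangular :=
      Matrix.blockTriangular_one
    constructor
    · rintro ⟨hU, hU2⟩
      refine ⟨U + 1, ⟨hU.add hone, ?_⟩, ?_⟩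
      · rw [(Commute.one_right U).add_sq, hU2, h2]; simp
      · simp only [add_assoc, one_add_one_eq_two, h2, add_zero]
    · rintro ⟨U, ⟨hU, hU2⟩, rfl⟩
      refine ⟨hU.add hone, ?_⟩
      rw [(Commute.one_right U).add_sq, hU2, h2]
      simp only [zero_mul, add_zero, one_pow, one_add_one_eq_two, h2]
  rw [himage, Set.ncard_image_of_injective _ (add_left_injective 1)]

theorem ncard_setB (n : ℕ) : ((setB n).ncard : ℚ) = ∑ᶠ j : ℤ, countTerm n j := by
  rw [← rankSum_one]
  exact eq_finsum_countTerm (fun n x => rankSum (setB n) x)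
    (rankSum_zero_dim ⟨Matrix.blockTriangular_zero, Subsingleton.elim _ _⟩) rankSum_setB_succ n

theorem ncard_setC (n : ℕ) : ((setC n).ncard : ℚ) = ∑ᶠ j : ℤ, countTerm n j := by
  rw [← rankSum_one]
  exact eq_finsum_countTerm (fun n x => rankSum (setC n) x)
    (rankSum_zero_dim ⟨Matrix.blockTriangular_zero, Subsingleton.elim _ _⟩) rankSum_setC_succ n

theorem mainTheorem2 (n : ℕ) (hn : 0 < n) :
    (setA n).ncard = (setB n).ncard ∧
    (setB n).ncard = (setC n).ncard ∧
    (Function.support (countTerm n)).Finite ∧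
    ((setC n).ncard : ℚ) = ∑ᶠ j : ℤ, countTerm n j :=
  ⟨ncard_setA_eq_ncard_setB n,
    by exact_mod_cast (ncard_setB n).trans (ncard_setC n).symm,
    (Finset.finite_toSet _).subset (support_countTerm_subset n), ncard_setC n⟩
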